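/- **Model.** Time is slotted and each slot has two subslots. A source $S$ always has a packet to send, a relay $R$ has an infinite data buffer and an energy buffer of size $N$, and $D$ is the destination. A relay transmission costs $K$ energy units. The numbers of units harvested in different harvesting slots are i.i.d. copies of $\Gamma\in\{0,\dots,b_{\max}\}$, where $b_{\max}$ is the largest value taken with positive probability, $b_{\max}\le K$ and $N\ge 2K$. The detection probabilities of the links $S$–$D$ and $R$–$D$ are $p_S\in(0,1)$ and $p_R\in(0,1]$; the link $S$–$R$ is ideal. The state at the beginning of a slot is $s=(q_d,q_e)\in\{0,1,\dots\}\times\{0,\dots,N\}$ (data packets and energy units at $R$). Under a dynamic policy $(\alpha_s)_s$, in state $s$ the relay decodes with probability $\alpha_s$ and otherwise harvests. In the first subslot, if it decodes, then $q_d$ increases by one with probability $1-p_S$ (when $D$ misses the source packet); if it harvests, then $q_e$ becomes $\min(q_e+\Gamma,N)$. In the second subslot $R$ is *active* if $q_d\ge1$ and $q_e\ge K$; then $q_e$ decreases by $K$, and $q_d$ decreases by one with probability $p_R$. If $R$ is not active nothing changes. A *steady state* is a policy together with a stationary law $(p_s)$ of the resulting Markov chain; a policy without a stationary law does not keep the data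 buffer stable and counts as having infinite delay. For a steady state let $\overline{\alpha}=\sum_s p_s\alpha_s$, let $\overline{q_d}$ be the mean of $q_d$, let $p^a_R$ be the probability that $R$ is active in a slot, and put $$\lambda_S=p_S+p^a_R\,p_R,\qquad \tau=\frac{\overline{q_d}+1}{\lambda_S},\qquad \overline{D_R}=\frac{\overline{q_d}}{\overline{\alpha}\,(1-p_S)}$$ (throughput, average transmission delay, average delay at the relay). **Proposition.** Let $b_{\max}=1$, and suppose that cooperation is preferred to non-cooperation: along some family of steady states whose average decoding probability $\overline{\alpha}>0$ tends to $0$ (for instance the static policies $\alpha_s\equiv\alpha$, $\alpha\to0^+$), $\overline{D_R}$ converges to a limit smaller than $1/p_S$. Consider the policy $$\alpha^D_s=1\ \text{ for } s=(0,N),\qquad \alpha^D_s=0\ \text{ otherwise}.$$ Then $\alpha^D$ has exactly one stationary law; its delay $\tau$ is finite and is minimal among all steady states of all dynamic policies, that is, $\alpha^D$ is delay-optimal. Under $\alpha^D$ the relay holds at most one packet: this is so with probability one in the steady state, and a slot that begins with at most one packet at the relay almost surely ends with at most one. Moreover $\alpha^D$ is throughput-optimal: its $\lambda_S$ is at least that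 of every steady state of every dynamic policy, and at least the long-run throughput (the upper limit of the time averages) of every dynamic policy, stable or not, from every initial state. -/

import Mathlib

open Filter Topology
open scoped NNReal ENNReal

noncomputable section

namespace EHRelay

/-- A biased coin: `true` with probability `p`, `false` with probability `1 - p`. -/
def coin (p : ℝ≥0) (hp : p ≤ 1) : PMF Bool :=
  PMF.ofFintype (fun b => if b then (p : ℝ≥0∞) else ((1 - p : ℝ≥0) : ℝ≥0∞)) (by
    rw [Fintype.sum_bool]
    simp only [if_true, Bool.false_eq_true, if_false]
    rw [← ENNReal.coe_add, add_tsub_cancel_of_le hp, ENNReal.coe_one])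

/-- Parameters of the slotted source / relay / destination network: a relay packet transmission
uses `K` energy units, the energy buffer holds at most `N` units, the number of units harvested
in an energy harvesting slot has law `harvest`, whose largest value is `bmax`, and `pS`, `pR` are
the detection probabilities of the source-destination and the relay-destination link. -/
structure Model where
  K : ℕ
  N : ℕ
  bmax : ℕ
  harvest : PMF ℕ
  pS : ℝ≥0
  pR : ℝ≥0
  isGreatest_bmax : IsGreatest harvest.support bmax
  bmax_le_K : bmax ≤ K
  two_mul_K_le_N : 2 * K ≤ N
  pS_pos : 0 < pS
  pS_lt_one : pS < 1
  pR_pos : 0 < pR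
  pR_le_one : pR ≤ 1

namespace Model

variable (M : Model)

/-- A state `(q_d, q_e)`: number of data packets and number of energy units at the relay. -/
abbrev State : Type := ℕ × Fin (M.N + 1)

/-- A dynamic policy: in state `s` the relay selects the data decoding mode with probability
`dd s`, and the energy harvesting mode otherwise. -/
@[ext]
structure Policy where
  dd : M.State → ℝ≥0
  dd_le_one : ∀ s, dd s ≤ 1

variable {M}

/-- The energy level after `m` further units have been harvested; the excess over `N` is lost. -/
def charge (e : Fin (M.N + 1)) (m : ℕ) : Fin (M.N + 1) :=
  ⟨min ((e : ℕ) + m) M.N, Nat.lt_succ_of_le (min_le_right _ _)⟩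

/-- The energy level after one relay transmission (used only when `K ≤ e`). -/
def discharge (e : Fin (M.N + 1)) : Fin (M.N + 1) :=
  ⟨(e : ℕ) - M.K, lt_of_le_of_lt (Nat.sub_le _ _) e.isLt⟩

/-- Given the state at the beginning of the second subslot: the relay is active, that is, it has a
data packet and at least `K` energy units. -/
abbrev Active (s : M.State) : Prop := 1 ≤ s.1 ∧ M.K ≤ (s.2 : ℕ)

/-- Law of the state at the end of the first subslot, from the state at the beginning of the slot.
In the decoding mode the source packet joins the data buffer unless the destination has detected
it; in the harvesting mode the energy buffer is charged. -/
def firstSubslot (A : M.Policy) (s : M.State) : PMF M.State :=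
  (coin (A.dd s) (A.dd_le_one s)).bind fun decode =>
    if decode then
      (coin M.pS M.pS_lt_one.le).map fun detected =>
        if detected then s else (s.1 + 1, s.2)
    else
      M.harvest.map fun m => (s.1, charge s.2 m)

/-- Law of the state at the end of the second subslot. An active relay spends `K` energy units on
transmitting its head-of-line packet, which leaves when the destination detects it. -/
def secondSubslot (s : M.State) : PMF M.State :=
  if Active s then
    (coin M.pR M.pR_le_one).map fun detected =>
      if detected then (s.1 - 1, discharge s.2) else (s.1, discharge s.2)
  else PMF.pure s

/-- The one-slot transition law of the state under the policy `A`. -/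
def step (A : M.Policy) (s : M.State) : PMF M.State :=
  (firstSubslot A s).bind secondSubslot

/-- Law of the state at the beginning of slot `n`, when slot `0` begins in state `s`. -/
def lawAt (A : M.Policy) (s : M.State) : ℕ → PMF M.State
  | 0 => PMF.pure s
  | n + 1 => (lawAt A s n).bind (step A)

/-- Probability that the relay is active in a slot that begins with state law `μ`. -/
def activeProb (A : M.Policy) (μ : PMF M.State) : ℝ≥0∞ :=
  ∑' s : M.State, if Active s then (μ.bind (firstSubslot A)) s else 0

/-- Long-run rate of packets detected at the destination (upper limit of the time averages), for
an arbitrary policy, stable or not, and an arbitrary initial state. -/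
def longRunThroughput (A : M.Policy) (s : M.State) : ℝ≥0∞ :=
  limsup (fun n : ℕ =>
    (M.pS : ℝ≥0∞) + (∑ t ∈ Finset.range n, activeProb A (lawAt A s t)) / n * M.pR) atTop

variable (M) in
/-- A policy together with a stationary law of the state under it. A policy for which there is no
stationary law does not keep the data buffer stable, and its delay counts as infinite. -/
@[ext]
structure SteadyState where
  policy : M.Policy
  law : PMF M.State
  stationary : law.bind (step policy) = law

namespace SteadyState

/-- The average data decoding probability. -/
def avgDD (X : M.SteadyState) : ℝ≥0∞ := ∑' s : M.State, X.law s * X.policy.dd s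

/-- The average number of data packets at the relay. -/
def meanQueue (X : M.SteadyState) : ℝ≥0∞ := ∑' s : M.State, X.law s * s.1

/-- The source throughput: the rate at which packets are detected at the destination. -/
def throughput (X : M.SteadyState) : ℝ≥0∞ := M.pS + activeProb X.policy X.law * M.pR

/-- The average system delay at the relay: mean number of packets divided by arrival rate. -/
def relayDelay (X : M.SteadyState) : ℝ≥0∞ :=
  X.meanQueue / (X.avgDD * ((1 - M.pS : ℝ≥0) : ℝ≥0∞))

/-- The average transmission delay of the source packets: mean number of packets in the whole
system (the source always has exactly one in service) divided by the throughput. -/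
def delay (X : M.SteadyState) : ℝ≥0∞ := (X.meanQueue + 1) / X.throughput

/-- The average transmission delay is finite and minimal among all dynamic policies. -/
def IsDelayOptimal (X : M.SteadyState) : Prop :=
  X.delay ≠ ∞ ∧ ∀ Y : M.SteadyState, X.delay ≤ Y.delay

/-- The throughput is maximal among all dynamic policies, whether they are compared in a steady
state or, stable or not, through the long-run rate from an initial state. -/
def IsThroughputOptimal (X : M.SteadyState) : Prop :=
  (∀ Y : M.SteadyState, Y.throughput ≤ X.throughput) ∧
    ∀ (A : M.Policy) (s : M.State), longRunThroughput A s ≤ X.throughput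

end SteadyState

variable (M) in
/-- The policy that decodes in state `(0, N)` and harvests in every other state. -/
def fullBatteryPolicy : M.Policy where
  dd s := if s.1 = 0 ∧ (s.2 : ℕ) = M.N then 1 else 0
  dd_le_one s := by split_ifs <;> simp

end Model

end EHRelay

end

/-! Two potentials, compared with the stationary law through drift inequalities, carry the proof.
Write g for `chargeProb`. The `workload` g * q_d + (1 - pS) * q_e has its weights chosen so that
decoding and harvesting have the same maximal mean gain g * (1 - pS), whatever the policy, while an
active slot loses `workRate` in mean. Hence `workRate` times the probability of activity is at most
g * (1 - pS), with equality if no harvested unit overflows. In recurrent states the full battery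
policy never harvests into a full battery, so it attains the bound. Truncating q_d makes the
argument work without a finite mean queue and, summed over time, for unstable policies
(`workload_drift_le`, `workRate_mul_sum_activeProb_le`). The potential `holding` charges W for the
packet in service and c = V N for each waiting packet, where c is the expected stay of a packet that
finds an empty buffer and a full battery. No arrival can cost less than c, so the mean queue is at
least c times the arrival rate at the relay, with equality for the full battery policy
(`exists_relayDelay_bound`). Letting the given family tend to its limit yields c < 1 / pS. Flow
balance turns the arrival rate into the relay's delivery rate x, so the delay is at least (c * x +
1) / (pS + x). This is nonincreasing in x when c * pS ≤ 1, and the full battery policy has equality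
together with the largest x. -/

namespace EHRelay

/-! ### Expected service time at the relay. -/

/-- The functional equation of the expected remaining time at the relay of the packet in service,
when no energy is lost and the relay always harvests: `W e` at the beginning of a slot, `V e` at
the beginning of the second subslot. -/
theorem exists_serviceTime (K : ℕ) (hK : 1 ≤ K) (g r : ℝ≥0) (hg : 0 < g) (hg1 : g ≤ 1)
    (hr : r < 1) :
    ∃ W V : ℕ → ℝ≥0, (∀ e, e < K → V e = W e) ∧ (∀ e, K ≤ e → V e = r * W (e - K)) ∧
      Antitone V ∧ ∀ e, W e = 1 + g * V (e + 1) + (1 - g) * V e := by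
  obtain ⟨g', hgg⟩ : ∃ g', g + g' = 1 := ⟨1 - g, add_tsub_cancel_of_le hg1⟩
  have hg' : 1 - g = g' := by rw [← hgg]; exact add_tsub_cancel_left _ _
  rw [hg']
  -- `W` is the least fixed point of a monotone operator with values in `ℝ≥0∞`: monotonicity follows
  -- by fixed point induction, finiteness from a finite supersolution.
  let V : (ℕ → ℝ≥0∞) → ℕ → ℝ≥0∞ := fun W e => if e < K then W e else r * W (e - K)
  have V_mono : Monotone V := by
    intro W W' h e
    simp only [V]
    split_ifs
    · exact h e
    · gcongr; exact h _
  let T : (ℕ → ℝ≥0∞) →o (ℕ → ℝ≥0∞) :=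
    ⟨fun W e => 1 + g * V W (e + 1) + g' * V W e, by
      intro W W' h e
      have h1 := V_mono h (e + 1)
      have h2 := V_mono h e
      simp only
      gcongr⟩
  have T_apply : ∀ W e, T W e = 1 + g * V W (e + 1) + g' * V W e := fun _ _ => rfl
  have hggE : (g : ℝ≥0∞) + g' = 1 := by exact_mod_cast hgg
  -- The second hypothesis handles the seam between `K - 1` and `K`, where the definition of `V`
  -- switches.
  have V_anti : ∀ W : ℕ → ℝ≥0∞, Antitone W → r * W 0 ≤ W (K - 1) → Antitone (V W) := by
    intro W hW h0
    refine antitone_nat_of_succ_le fun e => ?_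
    simp only [V]
    split_ifs with h1 h2 h2
    · exact hW (Nat.le_succ e)
    · omega
    · obtain rfl : e = K - 1 := by omega
      have : K - 1 + 1 - K = 0 := by omega
      rw [this]; exact h0
    · gcongr; exact hW (by omega)
  have key : Antitone T.lfp ∧ r * T.lfp 0 ≤ T.lfp (K - 1) := by
    refine T.lfp_induction (p := fun W => Antitone W ∧ r * W 0 ≤ W (K - 1)) ?_ ?_
    · rintro W ⟨hW, h0⟩ -
      have hV := V_anti W hW h0
      refine ⟨?_, ?_⟩
      · intro e e' h
        simp only [T_apply]
        have h1 := hV h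
        have h2 : V W (e' + 1) ≤ V W (e + 1) := hV (by omega)
        gcongr
      · have hVK : V W K = r * W 0 := by simp [V]
        have hV0 : V W 0 = W 0 := by simp only [V]; rw [if_pos (by omega)]
        have hK1 : K - 1 + 1 = K := by omega
        have hr1 : (r : ℝ≥0∞) ≤ 1 := by exact_mod_cast hr.le
        calc r * T W 0 = r * (1 + g * V W 1 + g' * V W 0) := by rw [T_apply]
          _ ≤ r * (1 + g * V W 0 + g' * V W 0) := by
              have : V W 1 ≤ V W 0 := hV (by omega)
              gcongr
          _ = r * 1 + r * ((g + g') * W 0) := by rw [hV0]; ring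
          _ ≤ 1 + r * W 0 := by
              rw [hggE, one_mul, mul_one]; gcongr
          _ = 1 + (g + g') * V W K := by rw [hggE, hVK, one_mul]
          _ ≤ 1 + g * V W K + g' * V W (K - 1) := by
              rw [add_mul, ← add_assoc]
              have : V W K ≤ V W (K - 1) := hV (by omega)
              gcongr
          _ = T W (K - 1) := by rw [T_apply, hK1]
    · intro s hs
      refine ⟨?_, ?_⟩
      · intro e e' h
        rw [sSup_apply, sSup_apply]
        exact iSup_mono fun W => (hs W W.2).1 h
      · rw [sSup_apply, sSup_apply, ENNReal.mul_iSup]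
        exact iSup_mono fun W => (hs W W.2).2
  have hfin : ∀ e, T.lfp e ≠ ∞ := by
    -- `b` solves b = r * (K / g + b): a failed transmission costs at most a full recharge, of mean
    -- length K / g, and another trial. `S` adds the mean time to reach `K` units; the maximum with
    -- 1 pays for the current slot when `K ≤ e`.
    let b : ℝ≥0 := r * (K / g) / (1 - r)
    let S : ℕ → ℝ≥0 := fun e => b + (max (K - e) 1 : ℕ) / g
    have hb : r * (K / g + b) = b := by
      obtain ⟨r', hr'⟩ : ∃ r', r + r' = 1 := ⟨1 - r, add_tsub_cancel_of_le hr.le⟩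
      have h1 : 1 - r = r' := by rw [← hr']; exact add_tsub_cancel_left _ _
      have h2 : r' ≠ 0 := by rintro rfl; simp at hr'; exact hr.ne hr'
      have h3 : b * r' = r * (K / g) := by simp only [b, h1]; field_simp
      calc r * (K / g + b) = r * (K / g) + r * b := by ring
        _ = b * (r + r') := by rw [← h3]; ring
        _ = b := by rw [hr', mul_one]
    have hVS : ∀ e, K ≤ e → V (fun e => (S e : ℝ≥0∞)) e ≤ b := by
      intro e he
      simp only [V]
      rw [if_neg (by omega)]
      have h1 : S (e - K) ≤ K / g + b := by
        simp only [S]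
        rw [add_comm]
        gcongr
        omega
      have h2 : r * S (e - K) ≤ b := (mul_le_mul_right h1 r).trans hb.le
      exact_mod_cast h2
    have hS : T.lfp ≤ fun e => (S e : ℝ≥0∞) := by
      refine T.lfp_le fun e => ?_
      rw [T_apply]
      rcases lt_or_ge e K with he | he
      · have h1 : V (fun e => (S e : ℝ≥0∞)) e = S e := by simp only [V]; rw [if_pos he]
        obtain ⟨j, rfl⟩ : ∃ j, K = e + 1 + j := ⟨K - (e + 1), by omega⟩
        have h2 : V (fun e => (S e : ℝ≥0∞)) (e + 1) ≤ (b + j / g : ℝ≥0) := by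
          rcases Nat.eq_zero_or_pos j with rfl | hj
          · simpa using hVS (e + 1) le_rfl
          · simp only [V]; rw [if_pos (by omega)]
            simp only [S]
            have : max (e + 1 + j - (e + 1)) 1 = j := by omega
            rw [this]
        have hSe : S e = b + (j + 1) / g := by
          simp only [S]
          have : max (e + 1 + j - e) 1 = j + 1 := by omega
          rw [this]; push_cast; rfl
        rw [h1]
        calc (1 : ℝ≥0∞) + g * V (fun e => (S e : ℝ≥0∞)) (e + 1) + g' * S e
            ≤ 1 + g * (b + j / g : ℝ≥0) + g' * S e := by gcongr
          _ = ((1 + g * (b + j / g) + g' * S e : ℝ≥0) : ℝ≥0∞) := by push_cast; rfl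
          _ = S e := by
            congr 1
            have : 1 + g * (b + j / g) = g * S e := by rw [hSe]; field_simp; ring
            rw [this, ← add_mul, hgg, one_mul]
      · calc (1 : ℝ≥0∞) + g * V (fun e => (S e : ℝ≥0∞)) (e + 1)
              + g' * V (fun e => (S e : ℝ≥0∞)) e ≤ 1 + g * b + g' * b := by
                have h1 := hVS e he
                have h2 := hVS (e + 1) (by omega)
                gcongr
          _ = b + 1 := by rw [add_assoc, ← add_mul, hggE, one_mul, add_comm]
          _ ≤ S e := by
            have h1 : (1 : ℝ≥0) ≤ (max (K - e) 1 : ℕ) / g := by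
              rw [one_le_div hg]
              refine hg1.trans ?_
              exact_mod_cast le_max_right _ _
            have h2 : b + 1 ≤ S e := by simp only [S]; gcongr
            exact_mod_cast h2
    exact fun e => ne_top_of_le_ne_top ENNReal.coe_ne_top (hS e)
  have hVfin : ∀ e, V T.lfp e ≠ ∞ := by
    intro e
    simp only [V]
    split_ifs
    · exact hfin e
    · exact ENNReal.mul_ne_top ENNReal.coe_ne_top (hfin _)
  refine ⟨fun e => (T.lfp e).toNNReal, fun e => (V T.lfp e).toNNReal, ?_, ?_, ?_, ?_⟩
  · intro e he
    simp only [V]; rw [if_pos he]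
  · intro e he
    simp only [V]; rw [if_neg (by omega)]; simp
  · intro e e' h
    exact ENNReal.toNNReal_mono (hVfin e) (V_anti _ key.1 key.2 h)
  · intro e
    have h : T.lfp e = T T.lfp e := by rw [T.map_lfp]
    rw [T_apply] at h
    rw [← ENNReal.coe_inj]
    push_cast
    rw [ENNReal.coe_toNNReal (hfin _), ENNReal.coe_toNNReal (hVfin _),
      ENNReal.coe_toNNReal (hVfin _)]
    exact h

/-! ### Existence and uniqueness of stationary laws. -/

/-- A Markov kernel that leaves a finite non-empty set invariant has a stationary law on it. -/
theorem exists_stationary {α : Type*} (k : α → PMF α) (T : Finset α) (hT : T.Nonempty)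
    (hk : ∀ a ∈ T, ∀ b, k a b ≠ 0 → b ∈ T) :
    ∃ μ : PMF α, μ.bind k = μ ∧ ∀ a, μ a ≠ 0 → a ∈ T := by
  classical
  let P : Matrix T T ℝ := fun i j => (k i j).toReal
  have hP0 : ∀ i j, 0 ≤ P i j := fun _ _ => ENNReal.toReal_nonneg
  have hP : ∀ i, ∑ j, P i j = 1 := by
    intro i
    have h1 : ∑ b ∈ T, k i b = 1 := by
      rw [← (k i).tsum_coe]
      refine (tsum_eq_sum fun b hb => ?_).symm
      by_contra h
      exact hb (hk i i.2 b h)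
    have h2 := congrArg ENNReal.toReal h1
    rw [ENNReal.toReal_sum (fun b _ => (k i).apply_ne_top b)] at h2
    simp only [P]
    rw [Finset.sum_coe_sort T (fun b => (k i b).toReal), h2]; rfl
  have : Nonempty T := hT.to_subtype
  -- The constant vector is in the right kernel of `P - 1`, so there is a left null vector too. Its
  -- absolute value is subinvariant and, the rows of `P` having sum 1, invariant.
  obtain ⟨v, hv0, hv⟩ : ∃ v : T → ℝ, v ≠ 0 ∧ Matrix.vecMul v (P - 1) = 0 := by
    rw [Matrix.exists_vecMul_eq_zero_iff, ← Matrix.exists_mulVec_eq_zero_iff]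
    refine ⟨1, one_ne_zero, ?_⟩
    rw [Matrix.sub_mulVec, Matrix.one_mulVec]
    ext i
    have := hP i
    simp only [Matrix.mulVec, dotProduct, Pi.sub_apply, Pi.one_apply, mul_one, Pi.zero_apply]
    rw [this, sub_self]
  have hvP : ∀ j, ∑ i, v i * P i j = v j := by
    intro j
    rw [Matrix.vecMul_sub, Matrix.vecMul_one, sub_eq_zero] at hv
    exact congrFun hv j
  have hle : ∀ j ∈ Finset.univ, |v j| ≤ ∑ i, |v i| * P i j := by
    intro j _
    rw [← hvP j]
    refine (Finset.abs_sum_le_sum_abs _ _).trans (Finset.sum_le_sum fun i _ => ?_)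
    rw [abs_mul, abs_of_nonneg (hP0 i j)]
  have heq : ∀ j, |v j| = ∑ i, |v i| * P i j := by
    have h : ∑ j, |v j| = ∑ j, ∑ i, |v i| * P i j := by
      rw [Finset.sum_comm]
      simp only [← Finset.mul_sum, hP, mul_one]
    intro j
    exact (Finset.sum_eq_sum_iff_of_le hle).1 h j (Finset.mem_univ j)
  have hpos : 0 < ∑ i, |v i| := by
    obtain ⟨i, hi⟩ := Function.ne_iff.1 hv0
    exact Finset.sum_pos' (fun _ _ => abs_nonneg _) ⟨i, Finset.mem_univ _, abs_pos.2 hi⟩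
  let f : α → ℝ≥0∞ := fun a => if h : a ∈ T then ENNReal.ofReal (|v ⟨a, h⟩| / ∑ i, |v i|) else 0
  have hfT : ∀ i : T, f i = ENNReal.ofReal (|v i| / ∑ i, |v i|) := fun i => by simp [f]
  have hf0 : ∀ a, a ∉ T → f a = 0 := fun a ha => by simp [f, ha]
  have hf1 : ∑ a ∈ T, f a = 1 := by
    rw [← Finset.sum_coe_sort T f]
    simp only [hfT]
    rw [← ENNReal.ofReal_sum_of_nonneg (fun i _ => by positivity), ← Finset.sum_div,
      div_self hpos.ne', ENNReal.ofReal_one]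
  refine ⟨PMF.ofFinset f T hf1 hf0, ?_, ?_⟩
  · ext b
    rw [PMF.bind_apply]
    simp only [PMF.ofFinset_apply]
    rw [tsum_eq_sum (s := T) (fun a ha => by rw [hf0 a ha, zero_mul])]
    by_cases hb : b ∈ T
    · rw [← Finset.sum_coe_sort T (fun a => f a * k a b)]
      have h1 : ∀ i : T, f i * k i b = ENNReal.ofReal (|v i| / (∑ i, |v i|) * P i ⟨b, hb⟩) := by
        intro i
        rw [hfT, ENNReal.ofReal_mul (by positivity), ENNReal.ofReal_toReal ((k i).apply_ne_top b)]
      simp only [h1]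
      rw [← ENNReal.ofReal_sum_of_nonneg
        (fun i _ => mul_nonneg (by positivity) (hP0 _ _)), hfT ⟨b, hb⟩, heq ⟨b, hb⟩,
        Finset.sum_div]
      congr 1
      exact Finset.sum_congr rfl fun i _ => by ring
    · rw [hf0 b hb]
      refine Finset.sum_eq_zero fun a ha => ?_
      have : k a b = 0 := by
        by_contra h
        exact hb (hk a ha b h)
      rw [this, mul_zero]
  · intro a ha
    by_contra h
    exact ha (by rw [PMF.ofFinset_apply]; exact hf0 a h)

/-- A Markov kernel with a state that belongs to every non-empty set which the kernel leaves
invariant has at most one stationary law. -/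
theorem stationary_unique {α : Type*} (k : α → PMF α) (z : α)
    (hz : ∀ S : Set α, S.Nonempty → (∀ a ∈ S, ∀ b, k a b ≠ 0 → b ∈ S) → z ∈ S)
    (μ ν : PMF α) (hμ : μ.bind k = μ) (hν : ν.bind k = ν) : μ = ν := by
  have hμ' : ∀ b, ∑' a, μ a * k a b = μ b := fun b => by rw [← PMF.bind_apply, hμ]
  have hν' : ∀ b, ∑' a, ν a * k a b = ν b := fun b => by rw [← PMF.bind_apply, hν]
  -- The minimum is subinvariant with finite mass, and the kernel preserves mass, so it is
  -- invariant.
  let m : α → ℝ≥0∞ := fun a => min (μ a) (ν a)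
  have hm_le : ∀ b, ∑' a, m a * k a b ≤ m b := by
    intro b
    refine le_min ?_ ?_
    · rw [← hμ' b]
      exact ENNReal.tsum_le_tsum fun a => mul_le_mul_left (min_le_left _ _) _
    · rw [← hν' b]
      exact ENNReal.tsum_le_tsum fun a => mul_le_mul_left (min_le_right _ _) _
  have hm_sum : ∑' b, ∑' a, m a * k a b = ∑' b, m b := by
    rw [ENNReal.tsum_comm]
    simp only [ENNReal.tsum_mul_left, PMF.tsum_coe, mul_one]
  have hm_fin : ∑' b, m b ≠ ∞ := by
    refine ne_top_of_le_ne_top ENNReal.one_ne_top ?_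
    rw [← μ.tsum_coe]
    exact ENNReal.tsum_le_tsum fun a => min_le_left _ _
  have hm : ∀ b, ∑' a, m a * k a b = m b := by
    intro b
    by_contra hne
    exact (ENNReal.tsum_lt_tsum (hm_sum ▸ hm_fin) hm_le (lt_of_le_of_ne (hm_le b) hne)).ne hm_sum
  -- The set where `m < ρ` is closed under the kernel, so it contains `z` as soon as it is
  -- non-empty. This cannot happen for both laws, since `m z` is one of `μ z` and `ν z`.
  have main : ∀ ρ : PMF α, (∀ b, ∑' a, ρ a * k a b = ρ b) → (∀ a, m a ≤ ρ a) →
      (∃ a, m a ≠ ρ a) → m z ≠ ρ z := by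
    intro ρ hρ hmρ hne
    refine hz {a | m a ≠ ρ a} hne fun a ha b hab hb => ?_
    have hlt : m a * k a b < ρ a * k a b :=
      ENNReal.mul_lt_mul_left hab ((k a).apply_ne_top b) (lt_of_le_of_ne (hmρ a) ha)
    have := ENNReal.tsum_lt_tsum (f := fun a => m a * k a b) (g := fun a => ρ a * k a b)
      (by rw [hm b, hb]; exact ρ.apply_ne_top b) (fun a => mul_le_mul_left (hmρ a) _) hlt
    rw [hm b, hρ b] at this
    exact this.ne hb
  have tot : ∀ ρ σ : PMF α, (∀ a, ρ a ≤ σ a) → ρ = σ := by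
    intro ρ σ h
    ext a
    by_contra hne
    have := ENNReal.tsum_lt_tsum (f := ρ) (g := σ) (by rw [ρ.tsum_coe]; exact ENNReal.one_ne_top)
      h (lt_of_le_of_ne (h a) hne)
    rw [ρ.tsum_coe, σ.tsum_coe] at this
    exact this.ne rfl
  by_cases h1 : ∃ a, m a ≠ μ a
  · by_cases h2 : ∃ a, m a ≠ ν a
    · have e1 := main μ hμ' (fun a => min_le_left _ _) h1
      have e2 := main ν hν' (fun a => min_le_right _ _) h2
      rcases min_choice (μ z) (ν z) with h | h
      · exact absurd h e1
      · exact absurd h e2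
    · push Not at h2
      exact (tot ν μ fun a => by rw [← h2 a]; exact min_le_left _ _).symm
  · push Not at h1
    exact tot μ ν fun a => by rw [← h1 a]; exact min_le_right _ _

/-! ### Expectations and drift inequalities. -/

/-- The expectation of a non-negative function. -/
noncomputable def expect {α : Type*} (μ : PMF α) (f : α → ℝ≥0∞) : ℝ≥0∞ := ∑' a, μ a * f a

section Expect

variable {α β : Type*}

theorem expect_pure (a : α) (f : α → ℝ≥0∞) : expect (PMF.pure a) f = f a := by
  rw [expect, tsum_eq_single a (fun b hb => by rw [PMF.pure_apply_of_ne _ _ hb, zero_mul]),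
    PMF.pure_apply_self, one_mul]

theorem expect_bind (μ : PMF α) (k : α → PMF β) (f : β → ℝ≥0∞) :
    expect (μ.bind k) f = expect μ fun a => expect (k a) f := by
  simp only [expect, PMF.bind_apply, ← ENNReal.tsum_mul_right, ← ENNReal.tsum_mul_left]
  rw [ENNReal.tsum_comm]
  simp only [mul_assoc]

theorem expect_map (μ : PMF α) (k : α → β) (f : β → ℝ≥0∞) :
    expect (μ.map k) f = expect μ fun a => f (k a) := by
  rw [PMF.map, expect_bind]
  simp only [Function.comp_apply, expect_pure]

theorem expect_add (μ : PMF α) (f g : α → ℝ≥0∞) :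
    expect μ (fun a => f a + g a) = expect μ f + expect μ g := by
  simp only [expect, mul_add, ENNReal.tsum_add]

theorem expect_const_mul (μ : PMF α) (c : ℝ≥0∞) (f : α → ℝ≥0∞) :
    expect μ (fun a => c * f a) = c * expect μ f := by
  simp only [expect, ← ENNReal.tsum_mul_left]
  congr 1; ext a; ring

theorem expect_const (μ : PMF α) (c : ℝ≥0∞) : expect μ (fun _ => c) = c := by
  simp only [expect, ENNReal.tsum_mul_right, PMF.tsum_coe, one_mul]

theorem expect_mono_of_support (μ : PMF α) {f g : α → ℝ≥0∞} (h : ∀ a, μ a ≠ 0 → f a ≤ g a) :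
    expect μ f ≤ expect μ g := by
  refine ENNReal.tsum_le_tsum fun a => ?_
  by_cases ha : μ a = 0
  · rw [ha, zero_mul, zero_mul]
  · exact mul_le_mul_right (h a ha) _

theorem expect_mono (μ : PMF α) {f g : α → ℝ≥0∞} (h : ∀ a, f a ≤ g a) :
    expect μ f ≤ expect μ g :=
  expect_mono_of_support μ fun a _ => h a

theorem expect_ne_top (μ : PMF α) {f : α → ℝ≥0∞} (c : ℝ≥0) (h : ∀ a, μ a ≠ 0 → f a ≤ c) :
    expect μ f ≠ ∞ := by
  have h1 := expect_mono_of_support μ h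
  rw [expect_const] at h1
  exact ne_top_of_le_ne_top ENNReal.coe_ne_top h1

theorem expect_coin (p : ℝ≥0) (hp : p ≤ 1) (f : Bool → ℝ≥0∞) :
    expect (coin p hp) f = p * f true + (1 - p : ℝ≥0) * f false := by
  rw [expect, tsum_bool, add_comm]
  rfl

theorem mem_support_coin_true {p : ℝ≥0} (hp : p ≤ 1) (h : p ≠ 0) :
    true ∈ (coin p hp).support := by
  rw [PMF.mem_support_iff]
  exact ENNReal.coe_ne_zero.2 h

theorem mem_support_coin_false {p : ℝ≥0} (hp : p ≤ 1) (h : p ≠ 1) :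
    false ∈ (coin p hp).support := by
  rw [PMF.mem_support_iff]
  exact ENNReal.coe_ne_zero.2 (tsub_pos_of_lt (lt_of_le_of_ne hp h)).ne'

/-- A drift inequality, with a potential `f` of finite mean, gives an inequality between the
stationary averages. -/
theorem expect_le_of_drift {μ : PMF α} {k : α → PMF α} (hμ : μ.bind k = μ)
    (f u v : α → ℝ≥0∞) (hf : expect μ f ≠ ∞)
    (h : ∀ a, μ a ≠ 0 → expect (k a) f + u a ≤ f a + v a) : expect μ u ≤ expect μ v := by
  have h1 := expect_mono_of_support μ h
  rw [expect_add, expect_add, ← expect_bind, hμ] at h1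
  exact (ENNReal.add_le_add_iff_left hf).1 h1

/-- The reverse of `expect_le_of_drift`. -/
theorem le_expect_of_drift {μ : PMF α} {k : α → PMF α} (hμ : μ.bind k = μ)
    (f u v : α → ℝ≥0∞) (hf : expect μ f ≠ ∞)
    (h : ∀ a, μ a ≠ 0 → f a + v a ≤ expect (k a) f + u a) : expect μ v ≤ expect μ u := by
  have h1 := expect_mono_of_support μ h
  rw [expect_add, expect_add, ← expect_bind, hμ] at h1
  exact (ENNReal.add_le_add_iff_left hf).1 h1

end Expect

namespace Model

variable {M : Model}

/-! ### Mean values over one slot. -/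

variable (M) in
/-- The probability that a unit is harvested in an energy harvesting slot. -/
noncomputable def chargeProb : ℝ≥0 := (M.harvest 1).toNNReal

theorem coe_chargeProb : (M.chargeProb : ℝ≥0∞) = M.harvest 1 :=
  ENNReal.coe_toNNReal (M.harvest.apply_ne_top 1)

theorem chargeProb_le_one : M.chargeProb ≤ 1 := by
  rw [← ENNReal.coe_le_coe, coe_chargeProb]; exact M.harvest.coe_le_one 1

theorem chargeProb_pos (hb : M.bmax = 1) : 0 < M.chargeProb := by
  rw [← ENNReal.coe_pos, coe_chargeProb, pos_iff_ne_zero]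
  exact (PMF.mem_support_iff _ _).1 (hb ▸ M.isGreatest_bmax.1)

theorem one_le_K (hb : M.bmax = 1) : 1 ≤ M.K := hb ▸ M.bmax_le_K

theorem harvest_eq_zero (hb : M.bmax = 1) {m : ℕ} (hm : 2 ≤ m) : M.harvest m = 0 := by
  by_contra h
  have := M.isGreatest_bmax.2 ((PMF.mem_support_iff _ _).2 h)
  omega

theorem expect_harvest (hb : M.bmax = 1) (f : ℕ → ℝ≥0∞) :
    expect M.harvest f = M.chargeProb * f 1 + (1 - M.chargeProb : ℝ≥0) * f 0 := by
  have key : ∀ f : ℕ → ℝ≥0∞, expect M.harvest f = M.chargeProb * f 1 + M.harvest 0 * f 0 := by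
    intro f
    rw [expect, tsum_eq_sum (s := {1, 0}), Finset.sum_pair one_ne_zero, coe_chargeProb]
    intro m hm
    simp only [Finset.mem_insert, Finset.mem_singleton, not_or] at hm
    rw [harvest_eq_zero hb (by omega), zero_mul]
  have h0 : M.harvest 0 = (1 - M.chargeProb : ℝ≥0) := by
    have h1 := key fun _ => 1
    rw [expect_const, mul_one, mul_one] at h1
    rw [ENNReal.coe_sub, ENNReal.coe_one, h1]
    exact (ENNReal.add_sub_cancel_left ENNReal.coe_ne_top).symm
  rw [key, h0]

@[simp]
theorem charge_zero (e : Fin (M.N + 1)) : charge e 0 = e := by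
  ext
  simp only [charge, add_zero]
  omega

@[simp]
theorem coe_charge (e : Fin (M.N + 1)) (m : ℕ) : (charge e m : ℕ) = min (e + m) M.N := rfl

@[simp]
theorem coe_discharge (e : Fin (M.N + 1)) : (discharge e : ℕ) = e - M.K := rfl

/-- The mean of `f` at the end of the second subslot. -/
noncomputable def secondMean (f : M.State → ℝ≥0) (s : M.State) : ℝ≥0 :=
  if Active s then M.pR * f (s.1 - 1, discharge s.2) + (1 - M.pR) * f (s.1, discharge s.2)
  else f s

/-- The mean of `f` at the end of the first subslot when at most one unit is harvested. -/
noncomputable def firstMean (A : M.Policy) (f : M.State → ℝ≥0) (s : M.State) : ℝ≥0 :=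
  A.dd s * (M.pS * f s + (1 - M.pS) * f (s.1 + 1, s.2)) +
    (1 - A.dd s) * (M.chargeProb * f (s.1, charge s.2 1) + (1 - M.chargeProb) * f s)

theorem expect_secondSubslot (f : M.State → ℝ≥0) (s : M.State) :
    expect (secondSubslot s) (fun t => (f t : ℝ≥0∞)) = secondMean f s := by
  unfold secondSubslot secondMean
  split_ifs
  · rw [expect_map, expect_coin]
    push_cast
    rfl
  · rw [expect_pure]

theorem expect_firstSubslot (hb : M.bmax = 1) (A : M.Policy) (f : M.State → ℝ≥0) (s : M.State) :
    expect (firstSubslot A s) (fun t => (f t : ℝ≥0∞)) = firstMean A f s := by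
  unfold firstSubslot firstMean
  rw [expect_bind, expect_coin]
  simp only [if_true, Bool.false_eq_true, if_false]
  rw [expect_map, expect_coin, expect_map, expect_harvest hb]
  simp only [if_true, Bool.false_eq_true, if_false, charge_zero]
  push_cast
  rfl

theorem expect_step (hb : M.bmax = 1) (A : M.Policy) (f : M.State → ℝ≥0) (s : M.State) :
    expect (step A s) (fun t => (f t : ℝ≥0∞)) = firstMean A (secondMean f) s := by
  rw [step, expect_bind]
  simp only [expect_secondSubslot]
  exact expect_firstSubslot hb A _ s

theorem firstMean_add (A : M.Policy) (f g : M.State → ℝ≥0) (s : M.State) :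
    firstMean A (fun t => f t + g t) s = firstMean A f s + firstMean A g s := by
  unfold firstMean; ring

theorem firstMean_const_mul (A : M.Policy) (c : ℝ≥0) (f : M.State → ℝ≥0) (s : M.State) :
    firstMean A (fun t => c * f t) s = c * firstMean A f s := by
  unfold firstMean; ring

theorem firstMean_mono (A : M.Policy) {f g : M.State → ℝ≥0} (h : ∀ t, f t ≤ g t) (s : M.State) :
    firstMean A f s ≤ firstMean A g s := by
  unfold firstMean
  have h1 := h s
  have h2 := h (s.1 + 1, s.2)
  have h3 := h (s.1, charge s.2 1)
  gcongr

/-! ### Activity, the workload potential and flow balance. -/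

/-- The indicator of the relay being active with at most `m` data packets. -/
noncomputable def activeUpTo (m : ℕ) (s : M.State) : ℝ≥0 := if Active s ∧ s.1 ≤ m then 1 else 0

theorem expect_activeUpTo_le (hb : M.bmax = 1) (A : M.Policy) (μ : PMF M.State) (m : ℕ) :
    expect μ (fun s => (firstMean A (activeUpTo m) s : ℝ≥0∞)) ≤ activeProb A μ := by
  simp only [← expect_firstSubslot hb]
  rw [← expect_bind]
  refine ENNReal.tsum_le_tsum fun s => ?_
  by_cases h1 : Active s
  · rw [if_pos h1]
    refine mul_le_of_le_one_right' ?_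
    simp only [activeUpTo]
    split_ifs <;> simp
  · simp [activeUpTo, h1]

/-- The probability of activity is the supremum of those with bounded queue length. -/
theorem activeProb_eq_iSup (hb : M.bmax = 1) (A : M.Policy) (μ : PMF M.State) :
    activeProb A μ = ⨆ m, expect μ (fun s => (firstMean A (activeUpTo m) s : ℝ≥0∞)) := by
  refine le_antisymm ?_ (iSup_le fun m => expect_activeUpTo_le hb A μ m)
  rw [activeProb, ENNReal.tsum_eq_iSup_sum]
  refine iSup_le fun T => ?_
  refine le_iSup_of_le (T.sup Prod.fst) ?_
  simp only [← expect_firstSubslot hb]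
  rw [← expect_bind]
  refine le_trans (Finset.sum_le_sum fun s hs => ?_) (ENNReal.sum_le_tsum T)
  by_cases h1 : Active s
  · simp only [activeUpTo]
    rw [if_pos h1, if_pos ⟨h1, Finset.le_sup (f := Prod.fst) hs⟩, ENNReal.coe_one, mul_one]
  · rw [if_neg h1]
    exact zero_le

theorem expect_activeUpTo_mono (A : M.Policy) (μ : PMF M.State) :
    Monotone fun m => expect μ (fun s => (firstMean A (activeUpTo m) s : ℝ≥0∞)) := by
  intro m m' h
  refine expect_mono μ fun s => ENNReal.coe_le_coe.2 (firstMean_mono A (fun t => ?_) s)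
  unfold activeUpTo
  split_ifs with h1 h2
  · exact le_rfl
  · exact absurd ⟨h1.1, h1.2.trans h⟩ h2
  · exact zero_le
  · exact le_rfl

/-- A combination of the numbers of data packets (counted up to `m`) and of energy units. -/
noncomputable def workload (m : ℕ) (s : M.State) : ℝ≥0 :=
  M.chargeProb * (min s.1 m : ℕ) + (1 - M.pS) * (s.2 : ℕ)

variable (M) in
/-- The decrease of the workload in a slot in which the relay is active. -/
noncomputable def workRate : ℝ≥0 := M.chargeProb * M.pR + (1 - M.pS) * M.K

/-- A transmission spends `K` units and removes a packet with probability `pR`; at queue lengths up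
to `m` the truncation is not felt, so the balance is exact. -/
theorem secondMean_workload (m : ℕ) (s : M.State) (hs : s.1 ≤ m) :
    secondMean (workload m) s + M.workRate * activeUpTo m s = workload m s := by
  obtain ⟨r, hr⟩ : ∃ r, M.pR + r = 1 := ⟨1 - M.pR, add_tsub_cancel_of_le M.pR_le_one⟩
  have hr' : 1 - M.pR = r := by rw [← hr]; exact add_tsub_cancel_left _ _
  obtain ⟨q, e⟩ := s
  unfold secondMean activeUpTo workload workRate
  rw [hr']
  dsimp only at hs ⊢
  by_cases hact : Active (q, e)
  · obtain ⟨h1, h2⟩ := id hact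
    obtain ⟨q, rfl⟩ : ∃ j, q = j + 1 := ⟨q - 1, by simp only at h1; omega⟩
    obtain ⟨j, hj⟩ : ∃ j, (e : ℕ) = M.K + j := ⟨e - M.K, by simp only at h2; omega⟩
    rw [if_pos hact]
    simp only [coe_discharge, hj, add_tsub_cancel_left, add_tsub_cancel_right]
    rw [if_pos ⟨hact, hs⟩, min_eq_left hs, min_eq_left (by omega)]
    push_cast
    calc _ = M.chargeProb * (M.pR + r) * q + M.chargeProb * (M.pR + r) +
          (1 - M.pS) * ((M.pR + r) * j) + (1 - M.pS) * M.K := by ring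
      _ = _ := by rw [hr]; ring
  · rw [if_neg hact, if_neg (fun h => hact h.1)]
    simp

/-- Above the truncation level the indicator vanishes, and the truncated workload cannot increase in
the second subslot. -/
theorem secondMean_workload_le (m : ℕ) (s : M.State) :
    secondMean (workload m) s + M.workRate * activeUpTo m s ≤ workload m s := by
  rcases le_or_gt s.1 m with hs | hs
  · exact (secondMean_workload m s hs).le
  obtain ⟨r, hr⟩ : ∃ r, M.pR + r = 1 := ⟨1 - M.pR, add_tsub_cancel_of_le M.pR_le_one⟩
  have hr' : 1 - M.pR = r := by rw [← hr]; exact add_tsub_cancel_left _ _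
  unfold secondMean activeUpTo workload
  rw [hr', if_neg (fun h : Active s ∧ s.1 ≤ m => absurd h.2 (not_le.2 hs)), mul_zero, add_zero]
  split_ifs with hact
  · rw [min_eq_right (by omega), min_eq_right (by omega)]
    simp only [coe_discharge]
    calc _ = (M.pR + r) * (M.chargeProb * m + (1 - M.pS) * (s.2 - M.K : ℕ)) := by ring
      _ ≤ _ := by
        rw [hr, one_mul]
        gcongr
        omega
  · exact le_rfl

/-- In no slot can the workload, corrected for the activity of the relay, grow in mean by more than
`chargeProb * (1 - pS)`. -/
theorem workload_drift_le (A : M.Policy) (m : ℕ) (s : M.State) :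
    firstMean A (secondMean (workload m)) s + M.workRate * firstMean A (activeUpTo m) s ≤
      workload m s + M.chargeProb * (1 - M.pS) := by
  rw [← firstMean_const_mul, ← firstMean_add]
  refine (firstMean_mono A (secondMean_workload_le m) s).trans ?_
  obtain ⟨a, ha⟩ : ∃ a, A.dd s + a = 1 := ⟨1 - A.dd s, add_tsub_cancel_of_le (A.dd_le_one s)⟩
  have ha' : 1 - A.dd s = a := by rw [← ha]; exact add_tsub_cancel_left _ _
  obtain ⟨p, hp⟩ : ∃ p, M.pS + p = 1 := ⟨1 - M.pS, add_tsub_cancel_of_le M.pS_lt_one.le⟩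
  have hp' : 1 - M.pS = p := by rw [← hp]; exact add_tsub_cancel_left _ _
  obtain ⟨g, hg⟩ : ∃ g, M.chargeProb + g = 1 :=
    ⟨1 - M.chargeProb, add_tsub_cancel_of_le chargeProb_le_one⟩
  have hg' : 1 - M.chargeProb = g := by rw [← hg]; exact add_tsub_cancel_left _ _
  have h1 : workload m (s.1 + 1, s.2) ≤ workload m s + M.chargeProb := by
    have : ((min (s.1 + 1) m : ℕ) : ℝ≥0) ≤ (min s.1 m : ℕ) + 1 := by
      exact_mod_cast (by omega : min (s.1 + 1) m ≤ min s.1 m + 1)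
    unfold workload
    calc _ ≤ M.chargeProb * ((min s.1 m : ℕ) + 1) + (1 - M.pS) * (s.2 : ℕ) := by gcongr
      _ = _ := by ring
  have h2 : workload m (s.1, charge s.2 1) ≤ workload m s + p := by
    have : ((charge s.2 1 : ℕ) : ℝ≥0) ≤ (s.2 : ℕ) + 1 := by
      rw [coe_charge]
      exact_mod_cast min_le_left _ _
    unfold workload
    rw [hp']
    calc _ ≤ M.chargeProb * (min s.1 m : ℕ) + p * ((s.2 : ℕ) + 1) := by
          dsimp only; gcongr
      _ = _ := by ring
  unfold firstMean
  rw [ha', hp', hg']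
  -- A packet worth `chargeProb` arrives with probability `p`, a unit worth `p` with probability
  -- `chargeProb`: the bounds on the gain agree and the decoding probability drops out.
  calc _ ≤ A.dd s * (M.pS * workload m s + p * (workload m s + M.chargeProb)) +
        a * (M.chargeProb * (workload m s + p) + g * workload m s) := by gcongr
    _ = A.dd s * ((M.pS + p) * workload m s) + a * ((M.chargeProb + g) * workload m s) +
        (A.dd s + a) * (M.chargeProb * p) := by ring
    _ = (A.dd s + a) * workload m s + (A.dd s + a) * (M.chargeProb * p) := by rw [hp, hg]; ring
    _ = _ := by rw [ha, one_mul, one_mul]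

/-- The balance of arrivals and departures in a slot. -/
theorem queue_drift (A : M.Policy) (s : M.State) :
    firstMean A (secondMean fun t => (t.1 : ℝ≥0)) s +
      M.pR * firstMean A (fun t => if Active t then 1 else 0) s = s.1 + A.dd s * (1 - M.pS) := by
  have h2 : ∀ t : M.State, secondMean (fun t => (t.1 : ℝ≥0)) t +
      M.pR * (if Active t then 1 else 0) = t.1 := by
    intro t
    obtain ⟨r, hr⟩ : ∃ r, M.pR + r = 1 := ⟨1 - M.pR, add_tsub_cancel_of_le M.pR_le_one⟩
    have hr' : 1 - M.pR = r := by rw [← hr]; exact add_tsub_cancel_left _ _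
    unfold secondMean
    split_ifs with h
    · obtain ⟨j, hj⟩ : ∃ j, t.1 = j + 1 := ⟨t.1 - 1, by have := h.1; omega⟩
      rw [hr', hj, add_tsub_cancel_right]
      push_cast
      calc _ = (M.pR + r) * j + (M.pR + r) := by ring
        _ = _ := by rw [hr, one_mul]
    · simp
  rw [← firstMean_const_mul, ← firstMean_add]
  simp only [h2]
  obtain ⟨a, ha⟩ : ∃ a, A.dd s + a = 1 := ⟨1 - A.dd s, add_tsub_cancel_of_le (A.dd_le_one s)⟩
  have ha' : 1 - A.dd s = a := by rw [← ha]; exact add_tsub_cancel_left _ _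
  obtain ⟨p, hp⟩ : ∃ p, M.pS + p = 1 := ⟨1 - M.pS, add_tsub_cancel_of_le M.pS_lt_one.le⟩
  have hp' : 1 - M.pS = p := by rw [← hp]; exact add_tsub_cancel_left _ _
  obtain ⟨g, hg⟩ : ∃ g, M.chargeProb + g = 1 :=
    ⟨1 - M.chargeProb, add_tsub_cancel_of_le chargeProb_le_one⟩
  have hg' : 1 - M.chargeProb = g := by rw [← hg]; exact add_tsub_cancel_left _ _
  unfold firstMean
  rw [ha', hp', hg']
  push_cast
  calc _ = A.dd s * ((M.pS + p) * s.1) + a * ((M.chargeProb + g) * s.1) + A.dd s * p := by ring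
    _ = (A.dd s + a) * s.1 + A.dd s * p := by rw [hp, hg]; ring
    _ = _ := by rw [ha, one_mul]

theorem activeProb_eq_expect (hb : M.bmax = 1) (A : M.Policy) (μ : PMF M.State) :
    activeProb A μ =
      expect μ fun s => (firstMean A (fun t => if Active t then 1 else 0) s : ℝ≥0∞) := by
  simp only [← expect_firstSubslot hb]
  rw [← expect_bind]
  refine tsum_congr fun s => ?_
  dsimp only
  by_cases h : Active s
  · rw [if_pos h, if_pos h, ENNReal.coe_one, mul_one]
  · rw [if_neg h, if_neg h, ENNReal.coe_zero, mul_zero]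

theorem activeProb_le_one (A : M.Policy) (μ : PMF M.State) : activeProb A μ ≤ 1 := by
  rw [← (μ.bind (firstSubslot A)).tsum_coe]
  refine ENNReal.tsum_le_tsum fun s => ?_
  split_ifs
  · exact le_rfl
  · exact zero_le

/-! ### Supports of the transitions and the chain of the full battery policy. -/

theorem mem_support_secondSubslot {s t : M.State} (h : t ∈ (secondSubslot s).support) :
    (Active s ∧ (t = (s.1 - 1, discharge s.2) ∨ t = (s.1, discharge s.2))) ∨
      (¬ Active s ∧ t = s) := by
  unfold secondSubslot at h
  split_ifs at h with hs
  · rw [PMF.mem_support_map_iff] at h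
    obtain ⟨b, -, rfl⟩ := h
    refine Or.inl ⟨hs, ?_⟩
    cases b <;> simp
  · rw [PMF.mem_support_pure_iff] at h
    exact Or.inr ⟨hs, h⟩

theorem mem_support_step {A : M.Policy} {s t : M.State} :
    step A s t ≠ 0 ↔ ∃ u ∈ (firstSubslot A s).support, t ∈ (secondSubslot u).support := by
  rw [← PMF.mem_support_iff, step, PMF.mem_support_bind_iff]

theorem dd_fullBatteryPolicy (s : M.State) :
    M.fullBatteryPolicy.dd s = if s.1 = 0 ∧ (s.2 : ℕ) = M.N then 1 else 0 := rfl

theorem mem_support_firstSubslot_of_dd_eq_zero {A : M.Policy} {s t : M.State} (h : A.dd s = 0) :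
    t ∈ (firstSubslot A s).support ↔ ∃ m ∈ M.harvest.support, t = (s.1, charge s.2 m) := by
  unfold firstSubslot
  rw [PMF.mem_support_bind_iff]
  constructor
  · rintro ⟨b, hb, ht⟩
    cases b
    · simp only [Bool.false_eq_true, if_false] at ht
      rw [PMF.mem_support_map_iff] at ht
      obtain ⟨m, hm, rfl⟩ := ht
      exact ⟨m, hm, rfl⟩
    · rw [PMF.mem_support_iff] at hb
      exact absurd (ENNReal.coe_eq_zero.2 h) hb
  · rintro ⟨m, hm, rfl⟩
    refine ⟨false, mem_support_coin_false _ (by rw [h]; exact zero_ne_one), ?_⟩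
    simp only [Bool.false_eq_true, if_false]
    rw [PMF.mem_support_map_iff]
    exact ⟨m, hm, rfl⟩

theorem mem_support_firstSubslot_of_dd_eq_one {A : M.Policy} {s t : M.State} (h : A.dd s = 1)
    (ht : t ∈ (firstSubslot A s).support) : t = s ∨ t = (s.1 + 1, s.2) := by
  unfold firstSubslot at ht
  rw [PMF.mem_support_bind_iff] at ht
  obtain ⟨b, hb, ht⟩ := ht
  cases b
  · rw [PMF.mem_support_iff] at hb
    refine absurd ?_ hb
    change ((1 - A.dd s : ℝ≥0) : ℝ≥0∞) = 0
    rw [h, tsub_self, ENNReal.coe_zero]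
  · simp only [if_true] at ht
    rw [PMF.mem_support_map_iff] at ht
    obtain ⟨d, -, rfl⟩ := ht
    cases d <;> simp

theorem K_le_N : M.K ≤ M.N := by have := M.two_mul_K_le_N; omega

/-- A slot with a packet at the relay does not end with a full battery. -/
theorem energy_lt_of_mem_support_step (hb : M.bmax = 1) {A : M.Policy} {s t : M.State}
    (h : step A s t ≠ 0) (ht : 1 ≤ t.1) : (t.2 : ℕ) < M.N := by
  obtain ⟨u, -, hu⟩ := mem_support_step.1 h
  have hK := one_le_K hb
  have hN := K_le_N (M := M)
  rcases mem_support_secondSubslot hu with ⟨-, rfl | rfl⟩ | ⟨h, rfl⟩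
  · have := u.2.isLt
    rw [coe_discharge]; omega
  · have := u.2.isLt
    rw [coe_discharge]; omega
  · have : ¬ M.K ≤ (t.2 : ℕ) := fun h' => h ⟨ht, h'⟩
    omega

theorem fullBatteryPolicy_step_le_one {s t : M.State} (hs : s.1 ≤ 1)
    (h : step M.fullBatteryPolicy s t ≠ 0) : t.1 ≤ 1 := by
  obtain ⟨u, hu, ht⟩ := mem_support_step.1 h
  have hu1 : u.1 ≤ 1 := by
    by_cases hd : s.1 = 0 ∧ (s.2 : ℕ) = M.N
    · rcases mem_support_firstSubslot_of_dd_eq_one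
        (by rw [dd_fullBatteryPolicy, if_pos hd]) hu with rfl | rfl
      · exact hs
      · simp [hd.1]
    · obtain ⟨m, -, rfl⟩ := (mem_support_firstSubslot_of_dd_eq_zero
        (by rw [dd_fullBatteryPolicy, if_neg hd])).1 hu
      exact hs
  rcases mem_support_secondSubslot ht with ⟨-, rfl | rfl⟩ | ⟨-, rfl⟩
  · exact (Nat.sub_le _ _).trans hu1
  · exact hu1
  · exact hu1

/-- The state with an empty data buffer and a full battery is reachable from everywhere. -/
theorem full_mem_of_closed (hb : M.bmax = 1) (S : Set M.State) (hS : S.Nonempty)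
    (hcl : ∀ s ∈ S, ∀ t, step M.fullBatteryPolicy s t ≠ 0 → t ∈ S) :
    ((0, Fin.last M.N) : M.State) ∈ S := by
  have hK := one_le_K hb
  have hN := K_le_N (M := M)
  have move : ∀ s ∈ S, ¬ (s.1 = 0 ∧ (s.2 : ℕ) = M.N) →
      ∀ t ∈ (secondSubslot (M := M) (s.1, charge s.2 1)).support, t ∈ S := by
    intro s hs hd t ht
    refine hcl s hs t (mem_support_step.2 ⟨_, ?_, ht⟩)
    rw [mem_support_firstSubslot_of_dd_eq_zero (by rw [dd_fullBatteryPolicy, if_neg hd])]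
    exact ⟨1, hb ▸ M.isGreatest_bmax.1, rfl⟩
  -- Lexicographic descent: one packet fewer outweighs any loss of energy, and a slot without
  -- transmission can gain a unit.
  have key : ∀ n, ∀ s ∈ S, s.1 * (M.N + 1) + (M.N - s.2) = n →
      ((0, Fin.last M.N) : M.State) ∈ S := by
    intro n
    induction n using Nat.strong_induction_on with
    | _ n ih =>
      rintro ⟨q, e⟩ hs hn
      have he := e.isLt
      dsimp only at hn
      by_cases hd : q = 0 ∧ (e : ℕ) = M.N
      · obtain ⟨rfl, h⟩ := hd
        have : e = Fin.last M.N := Fin.ext h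
        rw [← this]; exact hs
      · have hm := move (q, e) hs hd
        dsimp only at hm
        by_cases hact : Active ((q, charge e 1) : M.State)
        · have ht := hm (q - 1, discharge (charge e 1)) (by
            unfold secondSubslot
            rw [if_pos hact, PMF.mem_support_map_iff]
            exact ⟨true, mem_support_coin_true _ M.pR_pos.ne', rfl⟩)
          refine ih _ ?_ _ ht rfl
          have hq := hact.1
          obtain ⟨j, rfl⟩ : ∃ j, q = j + 1 := ⟨q - 1, by simp only at hq; omega⟩
          rw [← hn, add_tsub_cancel_right, add_mul, one_mul]
          simp only
          omega
        · have ht := hm (q, charge e 1) (by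
            unfold secondSubslot
            rw [if_neg hact, PMF.mem_support_pure_iff])
          refine ih _ ?_ _ ht rfl
          rw [← hn]
          have hlt : (e : ℕ) < M.N := by
            by_contra hge
            have heN : (e : ℕ) = M.N := by omega
            refine hact ⟨?_, ?_⟩
            · by_contra hq
              exact hd ⟨by simp only at hq; omega, heN⟩
            · rw [coe_charge]; omega
          simp only [coe_charge]
          omega
  obtain ⟨s, hs⟩ := hS
  exact key _ s hs rfl

theorem SteadyState.ext_of_fullBattery (hb : M.bmax = 1) (X Y : M.SteadyState)
    (hX : X.policy = M.fullBatteryPolicy) (hY : Y.policy = M.fullBatteryPolicy) : X = Y := by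
  refine SteadyState.ext (hX.trans hY.symm) ?_
  refine stationary_unique (step M.fullBatteryPolicy) (0, Fin.last M.N)
    (fun S hS hcl => full_mem_of_closed hb S hS hcl) _ _ ?_ ?_
  · have := X.stationary
    rwa [hX] at this
  · have := Y.stationary
    rwa [hY] at this

theorem exists_fullBattery_steadyState :
    ∃ X : M.SteadyState, X.policy = M.fullBatteryPolicy ∧ ∀ s, X.law s ≠ 0 → s.1 ≤ 1 := by
  obtain ⟨μ, hμ, hsupp⟩ := exists_stationary (step M.fullBatteryPolicy)
    (Finset.range 2 ×ˢ (Finset.univ : Finset (Fin (M.N + 1)))) ⟨(0, 0), by simp⟩ (by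
      intro s hs t ht
      simp only [Finset.mem_product, Finset.mem_range, Finset.mem_univ, and_true] at hs ⊢
      have := fullBatteryPolicy_step_le_one (by omega) ht
      omega)
  refine ⟨⟨M.fullBatteryPolicy, μ, hμ⟩, rfl, fun s hs => ?_⟩
  have := hsupp s hs
  simp only [Finset.mem_product, Finset.mem_range, Finset.mem_univ, and_true] at this
  omega

/-- By stationarity every charged state is the end of a slot. This rules out overflow while a packet
is at the relay. -/
theorem SteadyState.energy_lt (hb : M.bmax = 1) (X : M.SteadyState) {s : M.State}
    (hs : X.law s ≠ 0) (h1 : 1 ≤ s.1) : (s.2 : ℕ) < M.N := by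
  rw [← X.stationary, ← PMF.mem_support_iff, PMF.mem_support_bind_iff] at hs
  obtain ⟨a, -, ha⟩ := hs
  exact energy_lt_of_mem_support_step hb ((PMF.mem_support_iff _ _).1 ha) h1

/-! ### The holding cost potential. -/

/-- The potential in the bound for the holding cost: `W` is the expected remaining time of the
packet in service and each waiting packet counts `c`. -/
noncomputable def holding (W : ℕ → ℝ≥0) (c : ℝ≥0) (s : M.State) : ℝ≥0 :=
  if s.1 = 0 then 0 else W s.2 + (s.1 - 1 : ℕ) * c

theorem holding_zero (W : ℕ → ℝ≥0) (c : ℝ≥0) (e : Fin (M.N + 1)) :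
    holding W c ((0, e) : M.State) = 0 := rfl

theorem holding_succ (W : ℕ → ℝ≥0) (c : ℝ≥0) (q : ℕ) (e : Fin (M.N + 1)) :
    holding W c ((q + 1, e) : M.State) = W e + q * c := by
  simp [holding]

variable (M) in
/-- `W e` and `V e` are the expected remaining times at the relay of the packet in service, at the
beginning of a slot and of a second subslot with `e` energy units, when no energy is lost and the
relay always harvests. -/
structure IsServiceTime (W V : ℕ → ℝ≥0) : Prop where
  eq_of_lt : ∀ e, e < M.K → V e = W e
  eq_of_le : ∀ e, M.K ≤ e → V e = (1 - M.pR) * W (e - M.K)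
  anti : Antitone V
  eq_add : ∀ e, W e = 1 + M.chargeProb * V (e + 1) + (1 - M.chargeProb) * V e

theorem secondMean_holding_zero (W : ℕ → ℝ≥0) (c : ℝ≥0) (e : Fin (M.N + 1)) :
    secondMean (holding W c) ((0, e) : M.State) = 0 := by
  unfold secondMean
  rw [if_neg (fun h => absurd h.1 (by simp)), holding_zero]

namespace IsServiceTime

variable {W V : ℕ → ℝ≥0}

theorem secondMean_holding_one (h : M.IsServiceTime W V) (c : ℝ≥0) (e : Fin (M.N + 1)) :
    secondMean (holding W c) ((1, e) : M.State) = V e := by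
  unfold secondMean
  have h1 := fun e => holding_succ (M := M) W c 0 e
  rw [zero_add] at h1
  split_ifs with ha
  · rw [h1]
    simp only [tsub_self, holding_zero, coe_discharge]
    rw [h.eq_of_le _ ha.2]; simp
  · rw [h1, h.eq_of_lt _ (not_le.1 fun h' => ha ⟨le_rfl, h'⟩)]
    simp

theorem le_one_add (h : M.IsServiceTime W V) (e : ℕ) : W e ≤ 1 + V e := by
  have h1 : V (e + 1) ≤ V e := h.anti (Nat.le_succ e)
  calc W e = 1 + M.chargeProb * V (e + 1) + (1 - M.chargeProb) * V e := h.eq_add e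
    _ ≤ 1 + M.chargeProb * V e + (1 - M.chargeProb) * V e := by gcongr
    _ = 1 + V e := by
      rw [add_assoc, ← add_mul, add_tsub_cancel_of_le chargeProb_le_one, one_mul]

/-- `W e` is 1 plus an average of `V (e + 1)` and `V e`, and `V` is antitone. -/
theorem le_of_succ (h : M.IsServiceTime W V) (e : ℕ) : V (e + 1) ≤ W e := by
  have h1 : V (e + 1) ≤ V e := h.anti (Nat.le_succ e)
  calc V (e + 1) = (M.chargeProb + (1 - M.chargeProb)) * V (e + 1) := by
        rw [add_tsub_cancel_of_le chargeProb_le_one, one_mul]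
    _ ≤ 1 + (M.chargeProb * V (e + 1) + (1 - M.chargeProb) * V (e + 1)) := by
        rw [add_mul]; exact le_add_self
    _ ≤ 1 + (M.chargeProb * V (e + 1) + (1 - M.chargeProb) * V e) := by gcongr
    _ = W e := by rw [h.eq_add, add_assoc]

/-- When the head packet leaves, the next one starts with `e - K` units and needs `W (e - K) ≥ V (e
- K + 1) ≥ V N`, at least what it was charged while waiting. The last step uses `1 ≤ K`. -/
theorem le_secondMean_holding (h : M.IsServiceTime W V) (hK : 1 ≤ M.K) (q : ℕ)
    (e : Fin (M.N + 1)) :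
    V e + q * V M.N ≤ secondMean (holding W (V M.N)) ((q + 1, e) : M.State) := by
  have heN := e.isLt
  unfold secondMean
  split_ifs with ha
  · have haK : M.K ≤ (e : ℕ) := ha.2
    have h1 : q * V M.N ≤ holding W (V M.N) ((q, discharge e) : M.State) := by
      cases q with
      | zero => simp
      | succ j =>
        rw [holding_succ, coe_discharge]
        have h2 : V M.N ≤ W (e - M.K) := (h.anti (by omega)).trans (h.le_of_succ _)
        calc ((j + 1 : ℕ) : ℝ≥0) * V M.N = V M.N + j * V M.N := by push_cast; ring
          _ ≤ _ := by gcongr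
    simp only [add_tsub_cancel_right]
    rw [holding_succ, coe_discharge, h.eq_of_le _ haK]
    calc _ = (1 - M.pR) * W (e - M.K) + (M.pR + (1 - M.pR)) * (q * V M.N) := by
          rw [add_tsub_cancel_of_le M.pR_le_one, one_mul]
      _ = M.pR * (q * V M.N) + (1 - M.pR) * (W (e - M.K) + q * V M.N) := by ring
      _ ≤ _ := by gcongr
  · rw [holding_succ, h.eq_of_lt _ (not_le.1 fun h' => ha ⟨Nat.le_add_left _ _, h'⟩)]

/-- Up to the holding cost of the slot, each arriving packet raises the potential by at least the
delay of a packet that finds an empty buffer and a full battery. -/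
theorem holding_drift (h : M.IsServiceTime W V) (hK : 1 ≤ M.K) (A : M.Policy) (s : M.State) :
    holding W (V M.N) s + V M.N * (A.dd s * (1 - M.pS)) ≤
      firstMean A (secondMean (holding W (V M.N))) s + s.1 := by
  obtain ⟨q, e⟩ := s
  set c := V M.N with hc
  have he := Nat.lt_succ_iff.1 e.isLt
  obtain ⟨a, ha⟩ : ∃ a, A.dd (q, e) + a = 1 :=
    ⟨1 - A.dd (q, e), add_tsub_cancel_of_le (A.dd_le_one _)⟩
  have ha' : 1 - A.dd (q, e) = a := by rw [← ha]; exact add_tsub_cancel_left _ _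
  obtain ⟨p, hp⟩ : ∃ p, M.pS + p = 1 := ⟨1 - M.pS, add_tsub_cancel_of_le M.pS_lt_one.le⟩
  have hp' : 1 - M.pS = p := by rw [← hp]; exact add_tsub_cancel_left _ _
  obtain ⟨g, hg⟩ : ∃ g, M.chargeProb + g = 1 :=
    ⟨1 - M.chargeProb, add_tsub_cancel_of_le chargeProb_le_one⟩
  have hg' : 1 - M.chargeProb = g := by rw [← hg]; exact add_tsub_cancel_left _ _
  have hWe := h.eq_add e
  rw [hg'] at hWe
  unfold firstMean
  rw [ha', hp', hg']
  dsimp only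
  cases q with
  | zero =>
    have h2 := h.secondMean_holding_one c e
    rw [holding_zero, zero_add, secondMean_holding_zero, secondMean_holding_zero, zero_add, h2]
    have h3 : c ≤ V e := h.anti he
    simp only [mul_zero, add_zero, zero_add, Nat.cast_zero]
    calc c * (A.dd (0, e) * p) = A.dd (0, e) * (p * c) := by ring
      _ ≤ _ := by gcongr
  | succ q =>
    have h1 := h.le_secondMean_holding hK q e
    have h2 := h.le_secondMean_holding hK (q + 1) e
    have h3 := h.le_secondMean_holding hK q (charge e 1)
    have h4 : V (e + 1) ≤ V (charge e 1) := h.anti (by rw [coe_charge]; exact min_le_left _ _)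
    have h5 := h.le_one_add e
    rw [← hc] at h1 h2 h3
    -- Giving up the chance to harvest loses nothing here: the holding cost of the slot covers the
    -- at most one slot between `W e` and `V e`.
    have h6 : W e + q * c ≤ V e + q * c + (q + 1) := by
      calc W e + q * c ≤ 1 + V e + q * c := by gcongr
        _ ≤ 1 + V e + q * c + q := le_self_add
        _ = _ := by ring
    -- When harvesting, the functional equation of `W` applies; overflow only raises the right-hand
    -- side, by `h4`.
    have h7 : W e + q * c ≤ M.chargeProb * (V (e + 1) + q * c) + g * (V e + q * c) + (q + 1) := by
      calc W e + q * c = 1 + M.chargeProb * V (e + 1) + g * V e + (M.chargeProb + g) * (q * c) := by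
            rw [hWe, hg, one_mul]
        _ ≤ 1 + M.chargeProb * V (e + 1) + g * V e + (M.chargeProb + g) * (q * c) + q :=
            le_self_add
        _ = _ := by ring
    rw [holding_succ]
    push_cast at h2 ⊢
    calc W e + q * c + c * (A.dd (q + 1, e) * p)
        = A.dd (q + 1, e) * (M.pS * (W e + q * c) + p * (W e + q * c + c)) +
          a * (W e + q * c) := by
          calc _ = (A.dd (q + 1, e) + a) * (W e + q * c) + c * (A.dd (q + 1, e) * p) := by
                rw [ha, one_mul]
            _ = A.dd (q + 1, e) * ((M.pS + p) * (W e + q * c)) + a * (W e + q * c) +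
                c * (A.dd (q + 1, e) * p) := by rw [hp]; ring
            _ = _ := by ring
      _ ≤ A.dd (q + 1, e) * (M.pS * (V e + q * c + (q + 1)) + p * (V e + q * c + (q + 1) + c)) +
          a * (M.chargeProb * (V (e + 1) + q * c) + g * (V e + q * c) + (q + 1)) := by gcongr
      _ = A.dd (q + 1, e) * (M.pS * (V e + q * c) + p * (V e + (q + 1) * c)) +
          a * (M.chargeProb * (V (e + 1) + q * c) + g * (V e + q * c)) +
          (A.dd (q + 1, e) * (M.pS + p) + a) * (q + 1) := by ring
      _ = A.dd (q + 1, e) * (M.pS * (V e + q * c) + p * (V e + (q + 1) * c)) +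
          a * (M.chargeProb * (V (e + 1) + q * c) + g * (V e + q * c)) + (q + 1) := by
          rw [hp, mul_one, ha, one_mul]
      _ ≤ A.dd (q + 1, e) * (M.pS * (V e + q * c) + p * (V e + (q + 1) * c)) +
          a * (M.chargeProb * (V (charge e 1) + q * c) + g * (V e + q * c)) + (q + 1) := by
          gcongr
      _ ≤ _ := by gcongr

/-- Under the full battery policy the drift inequality is an equality in the recurrent states. -/
theorem holding_drift_fullBattery (h : M.IsServiceTime W V) (s : M.State) (hs : s.1 ≤ 1)
    (hs' : 1 ≤ s.1 → (s.2 : ℕ) < M.N) :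
    firstMean M.fullBatteryPolicy (secondMean (holding W (V M.N))) s + s.1 ≤
      holding W (V M.N) s + V M.N * (M.fullBatteryPolicy.dd s * (1 - M.pS)) := by
  obtain ⟨q, e⟩ := s
  dsimp only at hs hs'
  unfold firstMean
  rw [dd_fullBatteryPolicy]
  dsimp only
  obtain rfl | rfl : q = 0 ∨ q = 1 := by omega
  · have h2 := h.secondMean_holding_one (V M.N) e
    rw [holding_zero, secondMean_holding_zero, secondMean_holding_zero, zero_add, h2]
    split_ifs with hd
    -- Decoding takes place at energy `N` only, so the arrival costs exactly `V M.N`.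
    · rw [hd.2]
      simp [mul_comm]
    · simp
  · rw [if_neg (by simp), h.secondMean_holding_one, h.secondMean_holding_one, coe_charge,
      min_eq_left (hs' le_rfl)]
    have h1 := holding_succ (M := M) W (V M.N) 0 e
    rw [zero_add] at h1
    rw [h1, h.eq_add]
    apply le_of_eq
    simp
    ring

end IsServiceTime

theorem exists_isServiceTime (hb : M.bmax = 1) : ∃ W V, M.IsServiceTime W V := by
  obtain ⟨W, V, h1, h2, h3, h4⟩ := exists_serviceTime M.K (one_le_K hb) M.chargeProb (1 - M.pR)
    (chargeProb_pos hb) chargeProb_le_one (tsub_lt_self one_pos M.pR_pos)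
  exact ⟨W, V, h1, h2, h3, h4⟩

/-! ### Stationary bounds and long-run activity. -/

namespace SteadyState

theorem avgDD_eq (X : M.SteadyState) :
    X.avgDD = expect X.law fun s => (X.policy.dd s : ℝ≥0∞) := rfl

theorem meanQueue_eq (X : M.SteadyState) :
    X.meanQueue = expect X.law fun s => ((s.1 : ℝ≥0) : ℝ≥0∞) := by
  simp only [ENNReal.coe_natCast]; rfl

theorem expect_dd_mul (X : M.SteadyState) (c : ℝ≥0) :
    expect X.law (fun s => ((c * X.policy.dd s : ℝ≥0) : ℝ≥0∞)) = c * X.avgDD := by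
  simp only [ENNReal.coe_mul]
  rw [expect_const_mul, avgDD_eq]

/-- There is a constant which is at most the average delay at the relay in every steady
state, with equality for the full battery policy. -/
theorem exists_relayDelay_bound (hb : M.bmax = 1) :
    ∃ c : ℝ≥0, (∀ X : M.SteadyState, c * (X.avgDD * (1 - M.pS : ℝ≥0)) ≤ X.meanQueue) ∧
      ∀ X : M.SteadyState, X.policy = M.fullBatteryPolicy → (∀ s, X.law s ≠ 0 → s.1 ≤ 1) →
        X.meanQueue ≤ c * (X.avgDD * (1 - M.pS : ℝ≥0)) := by
  obtain ⟨W, V, h⟩ := exists_isServiceTime hb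
  -- `holding` grows at most linearly in the queue length, so its mean is finite with that of the
  -- queue.
  have hfin : ∀ X : M.SteadyState, X.meanQueue ≠ ∞ →
      expect X.law (fun s => (holding W (V M.N) s : ℝ≥0∞)) ≠ ∞ := by
    intro X hX
    have h1 : ∀ s : M.State, (holding W (V M.N) s : ℝ≥0∞) ≤
        (∑ e ∈ Finset.range (M.N + 1), W e : ℝ≥0) + V M.N * ((s.1 : ℝ≥0) : ℝ≥0∞) := by
      intro s
      have : holding W (V M.N) s ≤ (∑ e ∈ Finset.range (M.N + 1), W e) + V M.N * s.1 := by
        unfold holding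
        split_ifs
        · exact zero_le
        · rw [mul_comm (V M.N)]
          gcongr
          · exact Finset.single_le_sum (f := W) (fun _ _ => zero_le)
              (Finset.mem_range.2 s.2.isLt)
          · exact Nat.sub_le _ _
      exact_mod_cast this
    refine ne_top_of_le_ne_top ?_ (expect_mono X.law h1)
    rw [expect_add, expect_const, expect_const_mul, ← meanQueue_eq]
    exact ENNReal.add_ne_top.2 ⟨ENNReal.coe_ne_top, ENNReal.mul_ne_top ENNReal.coe_ne_top hX⟩
  have hv : ∀ X : M.SteadyState, expect X.law
      (fun s => ((V M.N * (X.policy.dd s * (1 - M.pS)) : ℝ≥0) : ℝ≥0∞)) =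
        V M.N * (X.avgDD * (1 - M.pS : ℝ≥0)) := by
    intro X
    have h1 := X.expect_dd_mul (V M.N * (1 - M.pS))
    rw [ENNReal.coe_mul] at h1
    rw [mul_comm X.avgDD, ← mul_assoc, ← h1]
    congr 1
    ext s
    congr 1
    ring
  refine ⟨V M.N, fun X => ?_, fun X hX hsupp => ?_⟩
  · by_cases hq : X.meanQueue = ∞
    · rw [hq]; exact le_top
    rw [← hv X, meanQueue_eq]
    refine le_expect_of_drift X.stationary _ _ _ (hfin X hq) fun s _ => ?_
    rw [expect_step hb]
    exact_mod_cast h.holding_drift (one_le_K hb) X.policy s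
  · have hq : X.meanQueue ≠ ∞ := by
      rw [meanQueue_eq]
      refine expect_ne_top _ 1 fun s hs => ?_
      exact_mod_cast hsupp s hs
    rw [← hv X, meanQueue_eq]
    refine expect_le_of_drift X.stationary _ _ _ (hfin X hq) fun s hs => ?_
    rw [expect_step hb, hX]
    exact_mod_cast h.holding_drift_fullBattery s (hsupp s hs) (X.energy_lt hb hs)

/-- Flow balance of the data buffer. -/
theorem activeProb_mul_pR (hb : M.bmax = 1) (X : M.SteadyState) (hq : X.meanQueue ≠ ∞) :
    activeProb X.policy X.law * M.pR = X.avgDD * (1 - M.pS : ℝ≥0) := by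
  rw [meanQueue_eq] at hq
  have hu : expect X.law (fun s => ((M.pR *
      firstMean X.policy (fun t => if Active t then 1 else 0) s : ℝ≥0) : ℝ≥0∞)) =
        activeProb X.policy X.law * M.pR := by
    simp only [ENNReal.coe_mul]
    rw [expect_const_mul, ← activeProb_eq_expect hb, mul_comm]
  have hv : expect X.law (fun s => ((X.policy.dd s * (1 - M.pS) : ℝ≥0) : ℝ≥0∞)) =
      X.avgDD * (1 - M.pS : ℝ≥0) := by
    rw [mul_comm, ← expect_dd_mul]
    simp only [mul_comm]
  rw [← hu, ← hv]
  have hd := fun s => queue_drift X.policy s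
  refine le_antisymm (expect_le_of_drift X.stationary _ _ _ hq fun s _ => ?_)
    (le_expect_of_drift X.stationary _ _ _ hq fun s _ => ?_)
  · rw [expect_step hb]
    exact_mod_cast (hd s).le
  · rw [expect_step hb]
    exact_mod_cast (hd s).ge

theorem expect_workload_ne_top (μ : PMF M.State) (m : ℕ) :
    expect μ (fun s => (workload m s : ℝ≥0∞)) ≠ ∞ := by
  refine expect_ne_top μ (M.chargeProb * m + (1 - M.pS) * M.N) fun s _ => ?_
  rw [ENNReal.coe_le_coe]
  unfold workload
  gcongr
  · exact min_le_right _ _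
  · exact Nat.lt_succ_iff.1 s.2.isLt

/-- The truncated workload is bounded, so its drift can be averaged under any stationary law, even
one with infinite mean queue; the supremum over `m` then recovers all activity. -/
theorem workRate_mul_activeProb_le (hb : M.bmax = 1) (X : M.SteadyState) :
    M.workRate * activeProb X.policy X.law ≤ (M.chargeProb * (1 - M.pS) : ℝ≥0) := by
  rw [activeProb_eq_iSup hb, ENNReal.mul_iSup]
  refine iSup_le fun m => ?_
  rw [← expect_const_mul, ← expect_const X.law ((M.chargeProb * (1 - M.pS) : ℝ≥0) : ℝ≥0∞)]
  refine expect_le_of_drift X.stationary _ _ _ (expect_workload_ne_top X.law m) fun s _ => ?_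
  rw [expect_step hb]
  exact_mod_cast workload_drift_le X.policy m s

/-- In the states of positive mass the workload drift is exact, as no unit overflows. Truncation at
2 suffices: at most one packet at the beginning of a slot, plus one arrival. -/
theorem le_workRate_mul_activeProb (hb : M.bmax = 1) (X : M.SteadyState)
    (hX : X.policy = M.fullBatteryPolicy) (hsupp : ∀ s, X.law s ≠ 0 → s.1 ≤ 1) :
    (M.chargeProb * (1 - M.pS) : ℝ≥0) ≤ M.workRate * activeProb X.policy X.law := by
  refine le_trans ?_ (mul_le_mul_right (expect_activeUpTo_le hb X.policy X.law 2) _)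
  rw [← expect_const_mul, ← expect_const X.law ((M.chargeProb * (1 - M.pS) : ℝ≥0) : ℝ≥0∞)]
  refine le_expect_of_drift X.stationary _ _ _ (expect_workload_ne_top X.law 2) fun s hs => ?_
  rw [expect_step hb, hX]
  have hs1 := hsupp s hs
  have hs2 := X.energy_lt hb hs
  suffices workload 2 s + M.chargeProb * (1 - M.pS) ≤
      firstMean M.fullBatteryPolicy (secondMean (workload 2)) s +
        M.workRate * firstMean M.fullBatteryPolicy (activeUpTo 2) s by exact_mod_cast this
  rw [← firstMean_const_mul, ← firstMean_add]
  have e1 := secondMean_workload 2 s (by omega)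
  have e2 := secondMean_workload (M := M) 2 (s.1 + 1, s.2) (by dsimp only; omega)
  have e3 := secondMean_workload (M := M) 2 (s.1, charge s.2 1) (by dsimp only; omega)
  obtain ⟨p, hp⟩ : ∃ p, M.pS + p = 1 := ⟨1 - M.pS, add_tsub_cancel_of_le M.pS_lt_one.le⟩
  have hp' : 1 - M.pS = p := by rw [← hp]; exact add_tsub_cancel_left _ _
  obtain ⟨g, hg⟩ : ∃ g, M.chargeProb + g = 1 :=
    ⟨1 - M.chargeProb, add_tsub_cancel_of_le chargeProb_le_one⟩
  have hg' : 1 - M.chargeProb = g := by rw [← hg]; exact add_tsub_cancel_left _ _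
  unfold firstMean
  simp only [e1, e2, e3]
  rw [dd_fullBatteryPolicy, hp', hg']
  apply le_of_eq
  split_ifs with hd
  · have : workload 2 (s.1 + 1, s.2) = workload 2 s + M.chargeProb := by
      unfold workload
      simp only [hd.1]
      norm_num
      ring
    rw [this, tsub_self, one_mul, zero_mul, add_zero]
    calc _ = (M.pS + p) * workload 2 s + M.chargeProb * p := by rw [hp, one_mul]
      _ = _ := by ring
  · have hlt : (s.2 : ℕ) < M.N := by
      have := s.2.isLt
      by_contra hge
      exact hge (hs2 (by by_contra h; exact hd ⟨by omega, by omega⟩))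
    have : workload 2 (s.1, charge s.2 1) = workload 2 s + p := by
      unfold workload
      simp only [coe_charge]
      rw [min_eq_left (by omega : (s.2 : ℕ) + 1 ≤ M.N), hp']
      push_cast
      ring
    rw [this, tsub_zero, one_mul, zero_mul, zero_add]
    calc _ = (M.chargeProb + g) * workload 2 s + M.chargeProb * p := by rw [hg, one_mul]
      _ = _ := by ring

end SteadyState

theorem workRate_pos (hb : M.bmax = 1) : 0 < M.workRate := by
  have h1 := chargeProb_pos hb
  have h2 := M.pR_pos
  unfold workRate
  positivity

/-- The bound for the expected number of active slots among the first `n`. -/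
theorem workRate_mul_sum_activeProb_le (hb : M.bmax = 1) (A : M.Policy) (s : M.State) (n : ℕ) :
    M.workRate * ∑ t ∈ Finset.range n, activeProb A (lawAt A s t) ≤
      (M.chargeProb * s.1 + (1 - M.pS) * (s.2 : ℕ) + n * (M.chargeProb * (1 - M.pS)) : ℝ≥0) := by
  -- The drift inequality telescopes for each fixed truncation `m`; monotonicity in `m` later moves
  -- the supremum out of the finite sum.
  have key : ∀ m n, expect (lawAt A s n) (fun s => (workload m s : ℝ≥0∞)) + M.workRate *
      ∑ t ∈ Finset.range n, expect (lawAt A s t)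
        (fun s => (firstMean A (activeUpTo m) s : ℝ≥0∞)) ≤
      workload m s + n * (M.chargeProb * (1 - M.pS) : ℝ≥0) := by
    intro m n
    induction n with
    | zero => simp [lawAt, expect_pure]
    | succ n ih =>
      have h1 := expect_mono (lawAt A s n) (f := fun t => expect (step A t)
        (fun s => (workload m s : ℝ≥0∞)) + M.workRate * firstMean A (activeUpTo m) t)
        (g := fun t => workload m t + (M.chargeProb * (1 - M.pS) : ℝ≥0)) (fun t => by
          rw [expect_step hb]
          exact_mod_cast workload_drift_le A m t)
      rw [expect_add, expect_add, expect_const, expect_const_mul, ← expect_bind] at h1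
      rw [Finset.sum_range_succ, lawAt, mul_add, add_comm (_ * _) (_ * _), ← add_assoc]
      calc _ ≤ _ := add_le_add_left h1 _
        _ = (expect (lawAt A s n) (fun s => (workload m s : ℝ≥0∞)) + M.workRate *
              ∑ t ∈ Finset.range n, expect (lawAt A s t)
                (fun s => (firstMean A (activeUpTo m) s : ℝ≥0∞))) +
              (M.chargeProb * (1 - M.pS) : ℝ≥0) := by ring
        _ ≤ _ := add_le_add_left ih _
        _ = _ := by push_cast; ring
  simp only [activeProb_eq_iSup hb]
  rw [ENNReal.finsetSum_iSup_of_monotone fun t => expect_activeUpTo_mono A (lawAt A s t),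
    ENNReal.mul_iSup]
  refine iSup_le fun m => (le_add_self.trans (key m n)).trans ?_
  have : workload m s ≤ M.chargeProb * s.1 + (1 - M.pS) * (s.2 : ℕ) := by
    unfold workload
    gcongr
    exact min_le_left _ _
  calc _ ≤ ((M.chargeProb * s.1 + (1 - M.pS) * (s.2 : ℕ) : ℝ≥0) : ℝ≥0∞) +
        n * (M.chargeProb * (1 - M.pS) : ℝ≥0) := by gcongr
    _ = _ := by push_cast; ring

/-! ### Comparison of delays and throughputs. -/

namespace SteadyState

theorem avgDD_le_one (X : M.SteadyState) : X.avgDD ≤ 1 := by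
  rw [avgDD_eq, ← expect_const X.law 1]
  exact expect_mono _ fun s => by exact_mod_cast X.policy.dd_le_one s

theorem throughput_ne_top (X : M.SteadyState) : X.throughput ≠ ∞ :=
  ENNReal.add_ne_top.2 ⟨ENNReal.coe_ne_top, ENNReal.mul_ne_top
    (ne_top_of_le_ne_top ENNReal.one_ne_top (activeProb_le_one _ _)) ENNReal.coe_ne_top⟩

theorem throughput_ne_zero (X : M.SteadyState) : X.throughput ≠ 0 := by
  unfold throughput
  have := M.pS_pos.ne'
  simp [this]

/-- Positive decoding is needed because `0 / 0 = 0` in `ℝ≥0∞`. -/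
theorem le_relayDelay {c : ℝ≥0} (X : M.SteadyState)
    (h : c * (X.avgDD * (1 - M.pS : ℝ≥0)) ≤ X.meanQueue) (hX : X.avgDD ≠ 0) :
    c ≤ X.relayDelay := by
  have hp : (1 - M.pS : ℝ≥0) ≠ 0 := (tsub_pos_of_lt M.pS_lt_one).ne'
  unfold relayDelay
  rw [ENNReal.le_div_iff_mul_le]
  · exact h
  · exact Or.inl (mul_ne_zero hX (ENNReal.coe_ne_zero.2 hp))
  · exact Or.inl (ENNReal.mul_ne_top (ne_top_of_le_ne_top ENNReal.one_ne_top X.avgDD_le_one)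
      ENNReal.coe_ne_top)

/-- If every packet costs at least `c < 1 / pS` slots at the relay, and no less is possible than
in `X`, where moreover the throughput is maximal, then the delay of `X` is minimal. -/
theorem delay_le_delay (hb : M.bmax = 1) {c : ℝ≥0} (hc : c * M.pS ≤ 1) (X Y : M.SteadyState)
    (hX : X.meanQueue ≤ c * (X.avgDD * (1 - M.pS : ℝ≥0)))
    (hY : c * (Y.avgDD * (1 - M.pS : ℝ≥0)) ≤ Y.meanQueue) (hXfin : X.meanQueue ≠ ∞)
    (hYX : activeProb Y.policy Y.law ≤ activeProb X.policy X.law) : X.delay ≤ Y.delay := by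
  by_cases hYfin : Y.meanQueue = ∞
  · unfold delay
    rw [hYfin, top_add, ENNReal.top_div_of_ne_top Y.throughput_ne_top]
    exact le_top
  rw [← X.activeProb_mul_pR hb hXfin] at hX
  rw [← Y.activeProb_mul_pR hb hYfin] at hY
  have hle : activeProb Y.policy Y.law * M.pR ≤ activeProb X.policy X.law * M.pR := by gcongr
  have hxfin : activeProb X.policy X.law * M.pR ≠ ∞ := ENNReal.mul_ne_top
    (ne_top_of_le_ne_top ENNReal.one_ne_top (activeProb_le_one _ _)) ENNReal.coe_ne_top
  have hT : X.throughput = M.pS + activeProb X.policy X.law * M.pR := rfl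
  have hT' : Y.throughput = M.pS + activeProb Y.policy Y.law * M.pR := rfl
  have hT0 := X.throughput_ne_zero
  have hT0' := Y.throughput_ne_zero
  have hTf := X.throughput_ne_top
  have hTf' := Y.throughput_ne_top
  unfold delay
  rw [hT] at hT0 hTf ⊢
  rw [hT'] at hT0' hTf' ⊢
  lift activeProb X.policy X.law * M.pR to ℝ≥0 using hxfin with x
  lift activeProb Y.policy Y.law * M.pR to ℝ≥0 using ne_top_of_le_ne_top ENNReal.coe_ne_top hle
    with y
  have hle' : y ≤ x := by exact_mod_cast hle
  calc (X.meanQueue + 1) / (M.pS + x) ≤ (c * x + 1) / (M.pS + x) := by gcongr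
    _ ≤ (c * y + 1) / (M.pS + y) := by
      rw [ENNReal.div_le_iff hT0 hTf, mul_comm (_ / _), ← mul_div_assoc, ENNReal.le_div_iff_mul_le
        (Or.inl hT0') (Or.inl hTf')]
      -- With `x = y + j` the two sides differ by `j * (1 - c * pS)`, which is where `hc` enters.
      have : (c * x + 1) * (M.pS + y) ≤ (M.pS + x) * (c * y + 1) := by
        obtain ⟨j, rfl⟩ := exists_add_of_le hle'
        calc (c * (y + j) + 1) * (M.pS + y)
            = (M.pS + y) * (c * y + 1) + c * M.pS * j + c * y * j := by ring
          _ ≤ (M.pS + y) * (c * y + 1) + 1 * j + c * y * j := by gcongr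
          _ = _ := by ring
      exact_mod_cast this
    _ ≤ _ := by gcongr

/-- A steady state which saturates the workload bound has maximal throughput. -/
theorem isThroughputOptimal_of_workload (hb : M.bmax = 1) (X : M.SteadyState)
    (h : (M.chargeProb * (1 - M.pS) : ℝ≥0) ≤ M.workRate * activeProb X.policy X.law) :
    X.IsThroughputOptimal := by
  have hw0 : (M.workRate : ℝ≥0∞) ≠ 0 := ENNReal.coe_ne_zero.2 (workRate_pos hb).ne'
  refine ⟨fun Y => ?_, fun A s => ?_⟩
  · have : activeProb Y.policy Y.law ≤ activeProb X.policy X.law :=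
      (ENNReal.mul_le_mul_iff_right hw0 ENNReal.coe_ne_top).1
        ((Y.workRate_mul_activeProb_le hb).trans h)
    unfold throughput
    gcongr
  · set x := activeProb X.policy X.law with hx
    -- `C` is the number of active slots that the initial workload can pay for; it vanishes in the
    -- time average.
    set C : ℝ≥0 := (M.chargeProb * s.1 + (1 - M.pS) * (s.2 : ℕ)) / M.workRate with hC
    have hsum : ∀ n : ℕ, ∑ t ∈ Finset.range n, activeProb A (lawAt A s t) ≤ C + n * x := by
      intro n
      refine (ENNReal.mul_le_mul_iff_right hw0 ENNReal.coe_ne_top).1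
        ((workRate_mul_sum_activeProb_le hb A s n).trans ?_)
      have h1 : M.chargeProb * s.1 + (1 - M.pS) * (s.2 : ℕ) = M.workRate * C := by
        rw [hC, mul_div_cancel₀ _ (workRate_pos hb).ne']
      rw [h1, ENNReal.coe_add, ENNReal.coe_mul, ENNReal.coe_mul, mul_add, ENNReal.coe_natCast]
      calc _ ≤ (M.workRate : ℝ≥0∞) * C + n * (M.workRate * x) := by gcongr
        _ = _ := by ring
    have hlim : Tendsto (fun n : ℕ => (M.pS : ℝ≥0∞) + (C * (n : ℝ≥0∞)⁻¹ + x) * M.pR) atTop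
        (𝓝 (M.pS + (C * 0 + x) * M.pR)) := by
      refine tendsto_const_nhds.add (ENNReal.Tendsto.mul_const ?_ (Or.inr ENNReal.coe_ne_top))
      exact (ENNReal.Tendsto.const_mul ENNReal.tendsto_inv_nat_nhds_zero
        (Or.inr ENNReal.coe_ne_top)).add tendsto_const_nhds
    rw [mul_zero, zero_add] at hlim
    change longRunThroughput A s ≤ M.pS + x * M.pR
    rw [← hlim.limsup_eq]
    refine limsup_le_limsup ?_
    filter_upwards [eventually_ge_atTop 1] with n hn
    have hn0 : (n : ℝ≥0∞) ≠ 0 := by exact_mod_cast (by omega : n ≠ 0)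
    have hav : (∑ t ∈ Finset.range n, activeProb A (lawAt A s t)) / n ≤ C * (n : ℝ≥0∞)⁻¹ + x := by
      rw [ENNReal.div_le_iff hn0 (ENNReal.natCast_ne_top n), add_mul, mul_assoc,
        ENNReal.inv_mul_cancel hn0 (ENNReal.natCast_ne_top n), mul_one, mul_comm x]
      exact hsum n
    gcongr

end SteadyState

end Model

end EHRelay

theorem proposition3 (M : EHRelay.Model) (hb : M.bmax = 1)
    {ι : Type*} (F : Filter ι) [F.NeBot] (Y : ι → M.SteadyState) (d : ℝ≥0∞)
    (hY : Tendsto (fun i => (Y i).avgDD) F (𝓝[>] 0))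
    (hd : Tendsto (fun i => (Y i).relayDelay) F (𝓝 d))
    (hcoop : d < 1 / (M.pS : ℝ≥0∞)) :
    ∃ X : M.SteadyState,
      X.policy = M.fullBatteryPolicy ∧
      (∀ X' : M.SteadyState, X'.policy = M.fullBatteryPolicy → X' = X) ∧
      X.IsDelayOptimal ∧
      (∀ s : M.State, X.law s ≠ 0 → s.1 ≤ 1) ∧
      (∀ s s' : M.State, s.1 ≤ 1 → EHRelay.Model.step M.fullBatteryPolicy s s' ≠ 0 → s'.1 ≤ 1) ∧
      X.IsThroughputOptimal := by
  obtain ⟨X, hX, hsupp⟩ := EHRelay.Model.exists_fullBattery_steadyState (M := M)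
  obtain ⟨c, hc, hcX⟩ := EHRelay.Model.SteadyState.exists_relayDelay_bound hb
  have hpS : (M.pS : ℝ≥0∞) ≠ 0 := ENNReal.coe_ne_zero.2 M.pS_pos.ne'
  -- Convergence within `𝓝[>] 0` makes the decoding probability eventually positive, so `c` bounds
  -- the relay delays and their limit.
  have hcd : (c : ℝ≥0∞) ≤ d := by
    refine ge_of_tendsto hd ?_
    filter_upwards [hY.eventually self_mem_nhdsWithin] with i hi
    exact (Y i).le_relayDelay (hc (Y i)) (Set.mem_Ioi.1 hi).ne'
  have hcp : c * M.pS ≤ 1 := by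
    have := (ENNReal.le_div_iff_mul_le (Or.inl hpS) (Or.inl ENNReal.coe_ne_top)).1
      (hcd.trans hcoop.le)
    exact_mod_cast this
  have hfin : X.meanQueue ≠ ∞ := by
    rw [X.meanQueue_eq]
    refine EHRelay.expect_ne_top _ 1 fun s hs => ?_
    exact_mod_cast hsupp s hs
  have hw := X.le_workRate_mul_activeProb hb hX hsupp
  have hw0 : (M.workRate : ℝ≥0∞) ≠ 0 := ENNReal.coe_ne_zero.2
    (EHRelay.Model.workRate_pos hb).ne'
  refine ⟨X, hX, fun X' hX' => X'.ext_of_fullBattery hb X hX' hX, ⟨?_, fun Z => ?_⟩, hsupp,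
    fun s s' hs h => EHRelay.Model.fullBatteryPolicy_step_le_one hs h,
    X.isThroughputOptimal_of_workload hb hw⟩
  · exact ENNReal.div_ne_top (ENNReal.add_ne_top.2 ⟨hfin, ENNReal.one_ne_top⟩)
      X.throughput_ne_zero
  · exact EHRelay.Model.SteadyState.delay_le_delay hb hcp X Z (hcX X hX hsupp) (hc Z) hfin
      ((ENNReal.mul_le_mul_iff_right hw0 ENNReal.coe_ne_top).1
        ((Z.workRate_mul_activeProb_le hb).trans hw))
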